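/- Let $k$ be a commutative ring and let $H$ be a Hopf $k$-algebra with comultiplication $\Delta$, counit $\varepsilon$ and antipode $S$. Assume that $H$ is involutory, i.e. $S^2=\mathrm{id}_H$, and that $H$ is a Frobenius $k$-algebra, i.e. $H$ is finitely generated projective over $k$ and isomorphic as a left $H$-module to $H^*=\operatorname{Hom}_k(H,k)$, where $(af)(x)=f(xa)$. Let $$\mathfrak{d}H=\varepsilon\big(\{a\in H : ba=\varepsilon(b)a \text{ for all } b\in H\}\big),$$ the ideal of $k$ formed by the values of $\varepsilon$ on the left integrals of $H$ (the right integrals give the same ideal). Let $B$ be a right $H$-comodule algebra with coaction $\rho\colon B\to B\otimes_k H$, let $A=B^{\mathrm{co}\,H}=\{a\in B:\rho(a)=a\otimes 1\}$ with inclusion $\iota\colon A\hookrightarrow B$, and assume that $B/A$ is $H$-Galois: at least one of the maps $B\otimes_A B\to B\otimes_k H$ given by $b\otimes b'\mapsto (b\otimes 1)\rho(b')$ and by $b\otimes b'\mapsto\rho(b)(b'\otimes 1)$ is bijective. For a ring $R$ let $[R,R]$ be the additive subgroup generated by all $xy-yx$ with $x,y\in R$, let $T(R)=R/[R,R]$,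 let $K_0(R)$ be the Grothendieck group of finitely generated projective left $R$-modules, and let $r_R\colon K_0(R)\to T(R)$ be the Hattori–Stallings rank: $r_R([P])=\sum_i \big(f_i(p_i)+[R,R]\big)$ for any finite dual bases $f_i\in\operatorname{Hom}_R(P,R)$, $p_i\in P$, that is, $x=\sum_i f_i(x)p_i$ for all $x\in P$. Then $B$ is finitely generated and projective as a left $A$-module, so that restriction $\operatorname{Res}^B_A\colon K_0(B)\to K_0(A)$, $[P]\mapsto[{}_AP]$, is defined, and the image of the composite $$T(\iota)\circ r_A\circ \operatorname{Res}^B_A\colon K_0(B)\to K_0(A)\to T(A)\to T(B)$$ is contained in $\big((\mathfrak{d}H)A+[B,B]\big)/[B,B]$. -/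

import Mathlib

open scoped TensorProduct

universe u v w

noncomputable section

/-! ### Lie commutators and Hattori–Stallings ranks -/

/-- The additive subgroup `[R, R]` generated by the Lie commutators `x * y - y * x`. -/
def lieCommutators (R : Type u) [Ring R] : AddSubgroup R :=
  AddSubgroup.closure {z | ∃ x y : R, z = x * y - y * x}

/-- `T(R) = R / [R, R]`. -/
abbrev TraceGroup (R : Type u) [Ring R] : Type u := R ⧸ lieCommutators R

namespace TraceGroup

/-- The canonical epimorphism `R → T(R)`. -/
def mk (R : Type u) [Ring R] : R →+ TraceGroup R := QuotientAddGroup.mk' (lieCommutators R)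

theorem mk_mul_comm {R : Type u} [Ring R] (x y : R) : mk R (x * y) = mk R (y * x) := by
  rw [← sub_eq_zero, ← map_sub]
  exact (QuotientAddGroup.eq_zero_iff _).2 (AddSubgroup.subset_closure ⟨x, y, rfl⟩)

/-- Functoriality: `T(f) : T(R) → T(S)`, `a + [R, R] ↦ f a + [S, S]`. -/
def map {R : Type u} {S : Type v} [Ring R] [Ring S] (f : R →+* S) :
    TraceGroup R →+ TraceGroup S :=
  QuotientAddGroup.map (lieCommutators R) (lieCommutators S) f.toAddMonoidHom (by
    rw [lieCommutators, AddSubgroup.closure_le]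
    rintro _ ⟨x, y, rfl⟩
    exact AddSubgroup.subset_closure ⟨f x, f y, by simp⟩)

end TraceGroup

/-- `f`, `p` are dual bases of the left `R`-module `P`: `x = ∑ i, f i x • p i` for all `x`. -/
def IsDualBases {R : Type u} {P : Type v} [Ring R] [AddCommGroup P] [Module R P]
    {ι : Type*} [Fintype ι] (f : ι → P →ₗ[R] R) (p : ι → P) : Prop :=
  ∀ x : P, x = ∑ i, f i x • p i

theorem exists_isDualBases (R : Type u) (P : Type v) [Ring R] [AddCommGroup P] [Module R P]
    [Module.Finite R P] [Module.Projective R P] :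
    ∃ (n : ℕ) (f : Fin n → P →ₗ[R] R) (p : Fin n → P), IsDualBases f p := by
  obtain ⟨n, π, σ, -, -, h⟩ := Module.Finite.exists_comp_eq_id_of_projective R P
  refine ⟨n, fun i => (LinearMap.proj i).comp σ, fun i => π (Pi.single i 1), fun x => ?_⟩
  have h1 : π (σ x) = x := LinearMap.congr_fun h x
  conv_lhs => rw [← h1, pi_eq_sum_univ' (σ x), map_sum]
  refine Finset.sum_congr rfl fun i _ => ?_
  rw [map_smul]
  congr 2

/-- The trace `Tr_{P/R}(φ) = ∑ i, T(f i (φ (p i))) ∈ T(R)` of an endomorphism `φ` of a finitely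
generated projective left `R`-module `P`, computed from some dual bases `f`, `p` of `P`
(by `hattoriTrace_eq` the choice is immaterial). -/
def hattoriTrace (R : Type u) (P : Type v) [Ring R] [AddCommGroup P] [Module R P]
    [Module.Finite R P] [Module.Projective R P] (φ : P →ₗ[R] P) : TraceGroup R :=
  ∑ i, TraceGroup.mk R ((exists_isDualBases R P).choose_spec.choose i
    (φ ((exists_isDualBases R P).choose_spec.choose_spec.choose i)))

theorem IsDualBases.sum_eq {R : Type u} {P : Type v} [Ring R] [AddCommGroup P] [Module R P]
    {ι κ : Type*} [Fintype ι] [Fintype κ] {f : ι → P →ₗ[R] R} {p : ι → P}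
    {g : κ → P →ₗ[R] R} {q : κ → P} (h : IsDualBases f p) (h' : IsDualBases g q)
    (φ : P →ₗ[R] P) :
    ∑ i, TraceGroup.mk R (f i (φ (p i))) = ∑ j, TraceGroup.mk R (g j (φ (q j))) := by
  have h1 : ∀ i, TraceGroup.mk R (f i (φ (p i))) =
      ∑ j, TraceGroup.mk R (f i (φ (q j)) * g j (p i)) := fun i => by
    conv_lhs => rw [h' (p i)]
    simp only [map_sum, map_smul, smul_eq_mul]
    exact Finset.sum_congr rfl fun j _ => TraceGroup.mk_mul_comm _ _
  have h2 : ∀ j, TraceGroup.mk R (g j (φ (q j))) =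
      ∑ i, TraceGroup.mk R (f i (φ (q j)) * g j (p i)) := fun j => by
    conv_lhs => rw [h (φ (q j))]
    simp only [map_sum, map_smul, smul_eq_mul]
  simp only [h1, h2]
  exact Finset.sum_comm

theorem hattoriTrace_eq {R : Type u} {P : Type v} [Ring R] [AddCommGroup P] [Module R P]
    [Module.Finite R P] [Module.Projective R P] {ι : Type*} [Fintype ι]
    {f : ι → P →ₗ[R] R} {p : ι → P} (h : IsDualBases f p) (φ : P →ₗ[R] P) :
    hattoriTrace R P φ = ∑ i, TraceGroup.mk R (f i (φ (p i))) :=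
  (exists_isDualBases R P).choose_spec.choose_spec.choose_spec.sum_eq h φ

/-- The Hattori–Stallings rank `r_R(P) = Tr_{P/R}(1_P)`. -/
def hattoriRank (R : Type u) (P : Type v) [Ring R] [AddCommGroup P] [Module R P]
    [Module.Finite R P] [Module.Projective R P] : TraceGroup R :=
  hattoriTrace R P LinearMap.id

theorem hattoriRank_congr {R : Type u} {P : Type v} {Q : Type w} [Ring R]
    [AddCommGroup P] [Module R P] [Module.Finite R P] [Module.Projective R P]
    [AddCommGroup Q] [Module R Q] [Module.Finite R Q] [Module.Projective R Q]
    (e : P ≃ₗ[R] Q) : hattoriRank R P = hattoriRank R Q := by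
  obtain ⟨n, f, p, h⟩ := exists_isDualBases R P
  have h' : IsDualBases (fun i => (f i).comp e.symm.toLinearMap) (fun i => e (p i)) := by
    intro x
    have := congrArg e (h (e.symm x))
    simpa using this
  rw [hattoriRank, hattoriRank, hattoriTrace_eq h, hattoriTrace_eq h']
  simp

theorem hattoriRank_prod (R : Type u) (P : Type v) (Q : Type w) [Ring R]
    [AddCommGroup P] [Module R P] [Module.Finite R P] [Module.Projective R P]
    [AddCommGroup Q] [Module R Q] [Module.Finite R Q] [Module.Projective R Q] :
    hattoriRank R (P × Q) = hattoriRank R P + hattoriRank R Q := by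
  obtain ⟨n, f, p, h⟩ := exists_isDualBases R P
  obtain ⟨m, g, q, h'⟩ := exists_isDualBases R Q
  have H : IsDualBases
      (Sum.elim (fun i => (f i).comp (LinearMap.fst R P Q))
        (fun j => (g j).comp (LinearMap.snd R P Q)))
      (Sum.elim (fun i => (p i, (0 : Q))) (fun j => ((0 : P), q j))) := by
    rintro ⟨x, y⟩
    rw [Fintype.sum_sum_type]
    simp only [Sum.elim_inl, Sum.elim_inr, LinearMap.comp_apply, LinearMap.fst_apply,
      LinearMap.snd_apply]
    ext
    · simpa [Prod.fst_sum] using h x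
    · simpa [Prod.snd_sum] using h' y
  rw [hattoriRank, hattoriRank, hattoriRank, hattoriTrace_eq h, hattoriTrace_eq h',
    hattoriTrace_eq H, Fintype.sum_sum_type]
  simp

/-! ### The Grothendieck group `K₀` -/

/-- Finitely generated projective left `R`-modules. -/
structure FGProj (R : Type u) [Ring R] : Type (u + 1) where
  carrier : Type u
  [addCommGroup : AddCommGroup carrier]
  [module : Module R carrier]
  [finite : Module.Finite R carrier]
  [projective : Module.Projective R carrier]

attribute [instance] FGProj.addCommGroup FGProj.module FGProj.finite FGProj.projective

/-- Isomorphism of finitely generated projective modules. -/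
instance FGProj.setoid (R : Type u) [Ring R] : Setoid (FGProj R) where
  r P Q := Nonempty (P.carrier ≃ₗ[R] Q.carrier)
  iseqv :=
    { refl := fun _ => ⟨LinearEquiv.refl _ _⟩
      symm := fun ⟨e⟩ => ⟨e.symm⟩
      trans := fun ⟨e⟩ ⟨e'⟩ => ⟨e.trans e'⟩ }

/-- Isomorphism classes of finitely generated projective left `R`-modules. -/
def FGProjClass (R : Type u) [Ring R] : Type (u + 1) := Quotient (FGProj.setoid R)

namespace FGProjClass

/-- The isomorphism class of a finitely generated projective module. -/
def mk {R : Type u} [Ring R] (P : FGProj R) : FGProjClass R := Quotient.mk _ P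

/-- The class of the zero module. -/
instance instZero (R : Type u) [Ring R] : Zero (FGProjClass R) where
  zero := mk (FGProj.mk PUnit)

/-- Addition of isomorphism classes is induced by the direct sum. -/
instance instAdd (R : Type u) [Ring R] : Add (FGProjClass R) where
  add := Quotient.map₂ (fun P Q => FGProj.mk (P.carrier × Q.carrier))
    fun _ _ ⟨e⟩ _ _ ⟨e'⟩ => ⟨LinearEquiv.prodCongr e e'⟩

instance instAddCommMonoid (R : Type u) [Ring R] : AddCommMonoid (FGProjClass R) where
  add_assoc := by
    rintro ⟨P⟩ ⟨Q⟩ ⟨S⟩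
    exact Quotient.sound ⟨LinearEquiv.prodAssoc R P.carrier Q.carrier S.carrier⟩
  zero_add := by
    rintro ⟨P⟩
    exact Quotient.sound ⟨LinearEquiv.uniqueProd⟩
  add_zero := by
    rintro ⟨P⟩
    exact Quotient.sound ⟨LinearEquiv.prodUnique⟩
  add_comm := by
    rintro ⟨P⟩ ⟨Q⟩
    exact Quotient.sound ⟨LinearEquiv.prodComm R P.carrier Q.carrier⟩
  nsmul := nsmulRec

end FGProjClass

/-- `K₀(R)`: the Grothendieck group of the monoid of isomorphism classes of finitely generated
projective left `R`-modules. -/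
abbrev K0 (R : Type u) [Ring R] : Type (u + 1) := Algebra.GrothendieckAddGroup (FGProjClass R)

namespace K0

/-- The class `[P] ∈ K₀(R)`. -/
def cls {R : Type u} [Ring R] (P : FGProj R) : K0 R :=
  Algebra.GrothendieckAddGroup.of (FGProjClass.mk P)

/-- The Hattori–Stallings rank `r_R : K₀(R) → T(R)`, `[P] ↦ r_R(P)`. -/
def rank (R : Type u) [Ring R] : K0 R →+ TraceGroup R :=
  Algebra.GrothendieckAddGroup.lift
    { toFun := Quotient.lift (fun P : FGProj R => hattoriRank R P.carrier)
        fun _ _ ⟨e⟩ => hattoriRank_congr e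
      map_zero' := by
        have h : IsDualBases (fun i : Fin 0 => (0 : PUnit.{u + 1} →ₗ[R] R)) (fun _ => 0) :=
          fun _ => rfl
        exact (hattoriTrace_eq h _).trans (by simp)
      map_add' := by
        rintro ⟨P⟩ ⟨Q⟩
        exact hattoriRank_prod R P.carrier Q.carrier }

theorem rank_cls {R : Type u} [Ring R] (P : FGProj R) :
    rank R (cls P) = hattoriRank R P.carrier :=
  DFunLike.congr_fun (Algebra.GrothendieckAddGroup.lift.symm_apply_apply _)
    (FGProjClass.mk P)

end K0

/-- If `B` is a finitely generated projective left module over a subalgebra `A`, then so is every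
finitely generated projective left `B`-module. -/
theorem finite_projective_restrict {k : Type v} {B : Type u} [CommRing k] [Ring B] [Algebra k B]
    (A : Subalgebra k B) [Module.Finite A B] [Module.Projective A B]
    (P : Type w) [AddCommGroup P] [Module B P] [Module.Finite B P] [Module.Projective B P] :
    Module.Finite A P ∧ Module.Projective A P := by
  obtain ⟨n, π, σ, -, -, h⟩ := Module.Finite.exists_comp_eq_id_of_projective B P
  have h' : (π.restrictScalars A).comp (σ.restrictScalars A) = LinearMap.id := by
    ext x
    exact LinearMap.congr_fun h x
  have : Module.Projective A (Fin n → B) :=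
    Module.Projective.of_equiv' (DFinsupp.linearEquivFunOnFintype (R := A) (M := fun _ : Fin n => B))
  refine ⟨Module.Finite.of_surjective (π.restrictScalars A) fun x => ⟨σ x, ?_⟩,
    Module.Projective.of_split _ _ h'⟩
  exact LinearMap.congr_fun h x

/-- Restriction of a finitely generated projective module to a subalgebra. -/
def FGProj.res {k : Type v} {B : Type u} [CommRing k] [Ring B] [Algebra k B]
    (A : Subalgebra k B) [Module.Finite A B] [Module.Projective A B] (P : FGProj B) : FGProj A :=
  haveI := (finite_projective_restrict A P.carrier).1
  haveI := (finite_projective_restrict A P.carrier).2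
  FGProj.mk P.carrier

/-- The restriction map `Res : K₀(B) → K₀(A)`, `[P] ↦ [_A P]`, for a subalgebra `A` of `B` such
that `B` is finitely generated and projective as a left `A`-module. -/
def K0.res {k : Type v} {B : Type u} [CommRing k] [Ring B] [Algebra k B]
    (A : Subalgebra k B) [Module.Finite A B] [Module.Projective A B] : K0 B →+ K0 A :=
  Algebra.GrothendieckAddGroup.lift
    { toFun := Quotient.lift (fun P : FGProj B => K0.cls (P.res A))
        fun _ _ ⟨e⟩ => congrArg Algebra.GrothendieckAddGroup.of
          (Quotient.sound ⟨(LinearEquiv.restrictScalars A e :)⟩)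
      map_zero' := by
        rw [← map_zero (Algebra.GrothendieckAddGroup.of (M := FGProjClass A))]
        exact congrArg Algebra.GrothendieckAddGroup.of
          (Quotient.sound ⟨(LinearEquiv.refl A PUnit.{u + 1} :)⟩)
      map_add' := by
        rintro ⟨P⟩ ⟨Q⟩
        refine Eq.trans ?_ (map_add (Algebra.GrothendieckAddGroup.of (M := FGProjClass A)) _ _)
        exact congrArg Algebra.GrothendieckAddGroup.of
          (Quotient.sound ⟨(LinearEquiv.refl A (P.carrier × Q.carrier) :)⟩) }

theorem K0.res_cls {k : Type v} {B : Type u} [CommRing k] [Ring B] [Algebra k B]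
    (A : Subalgebra k B) [Module.Finite A B] [Module.Projective A B] (P : FGProj B) :
    K0.res A (K0.cls P) = K0.cls (P.res A) :=
  DFunLike.congr_fun (Algebra.GrothendieckAddGroup.lift.symm_apply_apply _)
    (FGProjClass.mk P)

/-! ### Frobenius algebras, Hopf algebras and integrals -/

/-- A `k`-algebra `H` is Frobenius if it is finitely generated projective over `k` and isomorphic,
as a left `H`-module, to its dual `H*` with the action `(a f)(x) = f (x a)`. -/
def IsFrobeniusAlgebra (k : Type v) (H : Type w) [CommRing k] [Ring H] [Algebra k H] : Prop :=
  Module.Finite k H ∧ Module.Projective k H ∧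
    ∃ e : H ≃ₗ[k] Module.Dual k H, ∀ a b x : H, e (a * b) x = e b (x * a)

section Hopf

variable (k : Type v) (H : Type w) [CommRing k] [Ring H] [HopfAlgebra k H]

/-- A Hopf algebra is involutory if its antipode squares to the identity. -/
def IsInvolutory : Prop :=
  ∀ h : H, HopfAlgebra.antipode k (HopfAlgebra.antipode k h) = h

/-- The left integrals `{a | b a = ε(b) a for all b}`. -/
def leftIntegrals : Submodule k H where
  carrier := {a | ∀ b : H, b * a = Coalgebra.counit (R := k) b • a}
  add_mem' ha hb c := by rw [mul_add, ha c, hb c, smul_add]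
  zero_mem' c := by simp
  smul_mem' r a ha c := by rw [mul_smul_comm, ha c, smul_comm]

/-- The right integrals `{a | a b = ε(b) a for all b}`. -/
def rightIntegrals : Submodule k H where
  carrier := {a | ∀ b : H, a * b = Coalgebra.counit (R := k) b • a}
  add_mem' ha hb c := by rw [add_mul, ha c, hb c, smul_add]
  zero_mem' c := by simp
  smul_mem' r a ha c := by rw [smul_mul_assoc, ha c, smul_comm]

/-- The ideal `𝔡H = ε(∫ˡ)` of `k`. -/
def integralIdeal : Ideal k := (leftIntegrals k H).map (Coalgebra.counit (R := k) (A := H))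

/-- Right integrals define the same ideal. -/
theorem integralIdeal_eq_map_rightIntegrals (hH : IsInvolutory k H) :
    integralIdeal k H = (rightIntegrals k H).map (Coalgebra.counit (R := k) (A := H)) := by
  apply le_antisymm
  · rintro _ ⟨a, ha, rfl⟩
    refine ⟨HopfAlgebra.antipode k a, fun b => ?_, HopfAlgebra.counit_antipode a⟩
    rw [← hH b, ← HopfAlgebra.antipode_mul_antidistrib, ha, map_smul, hH,
      HopfAlgebra.counit_antipode]
  · rintro _ ⟨a, ha, rfl⟩
    refine ⟨HopfAlgebra.antipode k a, fun b => ?_, HopfAlgebra.counit_antipode a⟩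
    rw [← hH b, ← HopfAlgebra.antipode_mul_antidistrib, ha, map_smul, hH,
      HopfAlgebra.counit_antipode]

end Hopf

/-! ### Comodule algebras and Hopf–Galois extensions -/

/-- A right `H`-comodule algebra structure on the `k`-algebra `B`: a coassociative and counital
coaction `ρ : B → B ⊗ H` that is a homomorphism of `k`-algebras. -/
structure RightComoduleAlgebra (k : Type v) (H : Type w) (B : Type u) [CommRing k] [Ring H]
    [HopfAlgebra k H] [Ring B] [Algebra k B] where
  /-- the coaction -/
  coact : B →ₐ[k] B ⊗[k] H
  coassoc : (TensorProduct.assoc k B H H).toLinearMap ∘ₗ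
      coact.toLinearMap.rTensor H ∘ₗ coact.toLinearMap =
    (Coalgebra.comul (R := k) (A := H)).lTensor B ∘ₗ coact.toLinearMap
  counit : (TensorProduct.rid k B).toLinearMap ∘ₗ
      (Coalgebra.counit (R := k) (A := H)).lTensor B ∘ₗ coact.toLinearMap = LinearMap.id

/-- The relations `(b a) ⊗ b' - b ⊗ (a b')`, `a ∈ A`, in `B ⊗[k] B`. -/
def balancedRelations {k : Type v} {B : Type u} [CommRing k] [Ring B] [Algebra k B]
    (A : Subalgebra k B) : Submodule k (B ⊗[k] B) :=
  Submodule.span k {z | ∃ b b' : B, ∃ a ∈ A, z = (b * a) ⊗ₜ[k] b' - b ⊗ₜ[k] (a * b')}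

/-- The tensor product `B ⊗_A B` over a (not necessarily commutative) subalgebra `A` of `B`,
as the quotient of `B ⊗[k] B` by the balancing relations. -/
abbrev BalancedTensor {k : Type v} {B : Type u} [CommRing k] [Ring B] [Algebra k B]
    (A : Subalgebra k B) : Type u := (B ⊗[k] B) ⧸ balancedRelations A

namespace RightComoduleAlgebra

variable {k : Type v} {H : Type w} {B : Type u} [CommRing k] [Ring H] [HopfAlgebra k H]
  [Ring B] [Algebra k B] (ρ : RightComoduleAlgebra k H B)

/-- The coinvariants `A = {a | ρ(a) = a ⊗ 1}`. -/
def coinvariants : Subalgebra k B :=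
  AlgHom.equalizer ρ.coact (Algebra.TensorProduct.includeLeft : B →ₐ[k] B ⊗[k] H)

theorem mem_coinvariants {a : B} : a ∈ ρ.coinvariants ↔ ρ.coact a = a ⊗ₜ[k] (1 : H) :=
  Iff.rfl

/-- The canonical map `B ⊗_A B → B ⊗ H`, `b ⊗ b' ↦ (b ⊗ 1) ρ(b')`. -/
def leftCan : BalancedTensor ρ.coinvariants →ₗ[k] B ⊗[k] H :=
  (balancedRelations ρ.coinvariants).liftQ
    (LinearMap.mul' k (B ⊗[k] H) ∘ₗ TensorProduct.map
      (Algebra.TensorProduct.includeLeft : B →ₐ[k] B ⊗[k] H).toLinearMap ρ.coact.toLinearMap)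
    (by
      rw [balancedRelations, Submodule.span_le]
      rintro _ ⟨b, b', a, ha, rfl⟩
      have ha' := ρ.mem_coinvariants.1 ha
      simp [ha', ← mul_assoc])

theorem leftCan_mk_tmul (b b' : B) :
    ρ.leftCan (Submodule.Quotient.mk (b ⊗ₜ[k] b')) = (b ⊗ₜ[k] (1 : H)) * ρ.coact b' := by
  simp [leftCan]

/-- The canonical map `B ⊗_A B → B ⊗ H`, `b ⊗ b' ↦ ρ(b) (b' ⊗ 1)`. -/
def rightCan : BalancedTensor ρ.coinvariants →ₗ[k] B ⊗[k] H :=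
  (balancedRelations ρ.coinvariants).liftQ
    (LinearMap.mul' k (B ⊗[k] H) ∘ₗ TensorProduct.map ρ.coact.toLinearMap
      (Algebra.TensorProduct.includeLeft : B →ₐ[k] B ⊗[k] H).toLinearMap)
    (by
      rw [balancedRelations, Submodule.span_le]
      rintro _ ⟨b, b', a, ha, rfl⟩
      have ha' := ρ.mem_coinvariants.1 ha
      simp [ha', mul_assoc])

theorem rightCan_mk_tmul (b b' : B) :
    ρ.rightCan (Submodule.Quotient.mk (b ⊗ₜ[k] b')) = ρ.coact b * (b' ⊗ₜ[k] (1 : H)) := by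
  simp [rightCan]

/-- `B / B^{co H}` is `H`-Galois if one of the two canonical maps is bijective. -/
def IsHopfGalois : Prop :=
  Function.Bijective ρ.leftCan ∨ Function.Bijective ρ.rightCan

end RightComoduleAlgebra

end

/-!
Choose a left integral `Λ` of `H` and a left cointegral `l` with `Λ₁ l(Λ₂) = 1`; then `l` is a
Frobenius form with dual basis element `S(Λ₁) ⊗ Λ₂`. Since `B / A` is Galois there are `xᵢ, yᵢ` in
`B` with `∑ ρ(xᵢ)(yᵢ ⊗ 1) = 1 ⊗ Λ`, and with the trace `tr(b) = b₀ l(b₁)` from `B` to `A` one gets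
`b = ∑ tr(b xᵢ) yᵢ`, so the `tr(· xᵢ)` and `yᵢ` are dual bases of `B` over `A`. Consequently a
`B`-module with dual bases `fⱼ, pⱼ` has rank `∑ tr(yᵢ b xᵢ)` over `A`, where `b = ∑ fⱼ(pⱼ)`.

Modulo `[B, B]` the factors in `B` may be permuted cyclically, and
`∑ xᵢ₀ yᵢ₀ ⊗ yᵢ₁ ⊗ xᵢ₁ = 1 ⊗ S(Λ₁) ⊗ Λ₂`, so that `∑ tr(yᵢ b xᵢ) ≡ b₀ l(S(Λ₁) b₁ Λ₂)`.
Finally `l(S(Λ₁) h Λ₂) = ε(Λ) l(h)`: as `S² = id`, both sides are the trace of left multiplication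
by `h` on `H`, computed in the dual bases `l(S(Λ₁) ·), Λ₂` and `l(· Λ₂), S(Λ₁)`. Hence the rank is
the class of `ε(Λ) tr(b)`.
-/

noncomputable section

open Coalgebra HopfAlgebra

theorem IsDualBases.finite_projective {R P ι : Type*} [Ring R] [AddCommGroup P] [Module R P]
    [Fintype ι] {f : ι → P →ₗ[R] R} {p : ι → P} (h : IsDualBases f p) :
    Module.Finite R P ∧ Module.Projective R P := by
  have hsplit : Fintype.linearCombination R p ∘ₗ LinearMap.pi f = LinearMap.id := by
    ext x
    simpa [Fintype.linearCombination_apply] using (h x).symm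
  exact ⟨Module.Finite.of_surjective (Fintype.linearCombination R p) fun x =>
    ⟨LinearMap.pi f x, LinearMap.congr_fun hsplit x⟩, Module.Projective.of_split _ _ hsplit⟩

section Tower

variable {A B P ι κ : Type*} [Ring A] [Ring B] [Module A B] [IsScalarTower A B B]
  [AddCommGroup P] [Module A P] [Module B P] [IsScalarTower A B P] [Fintype ι] [Fintype κ]
  {g : ι → B →ₗ[A] A} {q : ι → B} {f : κ → P →ₗ[B] B} {p : κ → P}

theorem IsDualBases.trans (hg : IsDualBases g q) (hf : IsDualBases f p) :
    IsDualBases (fun i : ι × κ => g i.1 ∘ₗ (f i.2).restrictScalars A)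
      (fun i => q i.1 • p i.2) := by
  intro x
  calc x = ∑ j, f j x • p j := hf x
    _ = ∑ j, ∑ i, g i (f j x) • q i • p j := Finset.sum_congr rfl fun j _ => by
      conv_lhs => rw [hg (f j x)]
      simp only [Finset.sum_smul, smul_assoc]
    _ = _ := by rw [Fintype.sum_prod_type_right]; rfl

theorem hattoriRank_of_tower [Module.Finite A P] [Module.Projective A P]
    (hg : IsDualBases g q) (hf : IsDualBases f p) :
    hattoriRank A P = ∑ i, TraceGroup.mk A (g i (q i * ∑ j, f j (p j))) := by
  rw [hattoriRank, hattoriTrace_eq (hg.trans hf), Fintype.sum_prod_type]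
  simp [Finset.mul_sum]

end Tower

theorem TraceGroup.mk_injective (R : Type*) [CommRing R] :
    Function.Injective (TraceGroup.mk R) := by
  have hbot : lieCommutators R = ⊥ := by
    rw [lieCommutators, AddSubgroup.closure_eq_bot_iff]
    rintro _ ⟨x, y, rfl⟩
    exact sub_eq_zero.2 (mul_comm x y)
  rw [← AddMonoidHom.ker_eq_bot_iff, TraceGroup.mk, QuotientAddGroup.ker_mk', hbot]

theorem IsDualBases.trace_eq {R P ι κ : Type*} [CommRing R] [AddCommGroup P] [Module R P]
    [Fintype ι] [Fintype κ] {f : ι → P →ₗ[R] R} {p : ι → P} {g : κ → P →ₗ[R] R} {q : κ → P}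
    (hf : IsDualBases f p) (hg : IsDualBases g q) (φ : P →ₗ[R] P) :
    ∑ i, f i (φ (p i)) = ∑ j, g j (φ (q j)) :=
  TraceGroup.mk_injective R <| by simpa only [map_sum] using hf.sum_eq hg φ

theorem K0.range_le {R G : Type*} [Ring R] [AddCommGroup G] {Φ : K0 R →+ G} {N : AddSubgroup G}
    (h : ∀ P, Φ (K0.cls P) ∈ N) : Φ.range ≤ N := by
  have hof (c : FGProjClass R) : Φ (Algebra.GrothendieckAddGroup.of c) ∈ N := by
    obtain ⟨P⟩ := c
    exact h P
  rintro _ ⟨z, rfl⟩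
  rw [← Algebra.GrothendieckAddGroup.lift.apply_symm_apply Φ,
    Algebra.GrothendieckAddGroup.lift_apply]
  exact N.sub_mem (hof _) (hof _)

section Slice

variable {k M N N' : Type*} [CommRing k] [AddCommGroup M] [Module k M] [AddCommGroup N]
  [Module k N] [AddCommGroup N'] [Module k N']

/-- The slice map `m ⊗ n ↦ g n • m`, which applies the linear form `g` to the right factor. -/
def slice (g : Module.Dual k N) : M ⊗[k] N →ₗ[k] M :=
  (TensorProduct.rid k M).toLinearMap ∘ₗ g.lTensor M

@[simp]
theorem slice_tmul (g : Module.Dual k N) (m : M) (n : N) : slice g (m ⊗ₜ[k] n) = g n • m := by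
  simp [slice]

theorem slice_lTensor (g : Module.Dual k N') (T : N →ₗ[k] N') (t : M ⊗[k] N) :
    slice g (T.lTensor M t) = slice (g ∘ₗ T) t := by
  simp [slice, LinearMap.lTensor_comp_apply]

theorem slice_rTensor (g : Module.Dual k N') (T : M →ₗ[k] N) (t : M ⊗[k] N') :
    slice g (T.rTensor N' t) = T (slice g t) := by
  induction t <;> simp_all

theorem slice_tmul_mul {R S : Type*} [Ring R] [Algebra k R] [Ring S] [Algebra k S]
    (g : Module.Dual k S) (a : R) (h : S) (t : R ⊗[k] S) :
    slice g ((a ⊗ₜ[k] h) * t) = a * slice (g ∘ₗ LinearMap.mulLeft k h) t := by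
  induction t <;> simp_all [mul_add]

theorem slice_mul_tmul {R S : Type*} [Ring R] [Algebra k R] [Ring S] [Algebra k S]
    (g : Module.Dual k S) (t : R ⊗[k] S) (a : R) (h : S) :
    slice g (t * (a ⊗ₜ[k] h)) = slice (g ∘ₗ LinearMap.mulRight k h) t * a := by
  induction t <;> simp_all [add_mul]

theorem mk_slice_mul_tmul_mul {R S : Type*} [Ring R] [Algebra k R] [Ring S] [Algebra k S]
    (g : Module.Dual k S) (t r : R ⊗[k] S) (a : R) (h : S) :
    TraceGroup.mk R (slice g (t * (a ⊗ₜ[k] h) * r)) =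
      TraceGroup.mk R (a * slice (g ∘ₗ LinearMap.mul' k S ∘ₗ LinearMap.mulLeft k ((1 : S) ⊗ₜ[k] h))
        ((TensorProduct.mk k S S 1).lTensor R r *
          ((TensorProduct.mk k S S).flip 1).lTensor R t)) := by
  induction r with
  | zero => simp
  | add x y hx hy => simp only [map_add, mul_add, add_mul, hx, hy]
  | tmul p q =>
    induction t with
    | zero => simp
    | add x y hx hy => simp only [map_add, mul_add, add_mul, hx, hy]
    | tmul p' q' => simpa [mul_assoc] using TraceGroup.mk_mul_comm p' (g (q' * (h * q)) • (a * p))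

theorem lTensor_mul_of_map_mul {R C D : Type*} [Ring R] [Algebra k R] [Ring C] [Algebra k C]
    [Ring D] [Algebra k D] {T j T' : C →ₗ[k] D} (hT : ∀ a x, T (a * x) = j a * T' x)
    (s t : R ⊗[k] C) : T.lTensor R (s * t) = j.lTensor R s * T'.lTensor R t := by
  induction s with
  | zero => simp
  | add x y hx hy => simp only [map_add, add_mul, hx, hy]
  | tmul p q => induction t <;> simp_all [mul_add]

theorem map_slice_of_coassoc {C : Type*} [AddCommGroup C] [Module k C] [Coalgebra k C]
    {δ : M →ₗ[k] M ⊗[k] C}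
    (hδ : (TensorProduct.assoc k M C C).toLinearMap ∘ₗ δ.rTensor C ∘ₗ δ = comul.lTensor M ∘ₗ δ)
    (g : Module.Dual k C) (m : M) :
    δ (slice g (δ m)) = (slice g ∘ₗ comul).lTensor M (δ m) := by
  have slice_assoc (t : (M ⊗[k] C) ⊗[k] C) :
      slice g t = (slice g).lTensor M (TensorProduct.assoc k M C C t) := by
    induction t with
    | zero => simp
    | add x y hx hy => simp only [map_add, hx, hy]
    | tmul x c => induction x <;> simp_all [TensorProduct.add_tmul]
  rw [← slice_rTensor, slice_assoc, LinearMap.lTensor_comp_apply]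
  exact congrArg _ (LinearMap.congr_fun hδ m)

variable {C : Type*} [AddCommGroup C] [Module k C] [Coalgebra k C]

/-- The left action `g ⇀ c = c₁ g(c₂)` of linear forms on a coalgebra, as a linear map in `g`. -/
def hit (c : C) : Module.Dual k C →ₗ[k] C where
  toFun g := slice g (comul c)
  map_add' g g' := by simp [slice, LinearMap.lTensor_add]
  map_smul' r g := by simp [slice, LinearMap.lTensor_smul]

theorem hit_apply (c : C) (g : Module.Dual k C) : hit c g = slice g (comul c) := rfl

theorem counit_hit (c : C) (g : Module.Dual k C) : counit (R := k) (hit c g) = g c := by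
  conv_rhs => rw [← sum_counit_smul (ℛ k c)]
  simp [hit_apply, ← (ℛ k c).eq, mul_comm]

theorem hit_counit (c : C) : hit (k := k) c counit = c := by
  simp [hit_apply, slice]

theorem comul_hit (c : C) (g : Module.Dual k C) :
    comul (R := k) (hit c g) = (slice g ∘ₗ comul).lTensor C (comul c) :=
  map_slice_of_coassoc coassoc g c

theorem hit_hit (c : C) (f g : Module.Dual k C) :
    hit (hit c g) f = hit c (f ∘ₗ slice g ∘ₗ comul) := by
  rw [hit_apply, comul_hit, slice_lTensor, hit_apply]

end Slice

section Hopf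

variable {k H : Type*} [CommRing k] [Ring H] [HopfAlgebra k H]

/-- The map `a ⊗ b ↦ m (a ⊗ b₁) ⊗ b₂`. Applied to `Δ(c)`, with `m` one of the two products
`S(a) b` and `S(b) a`, it produces the antipode relations among three Sweedler factors. -/
def comulFold {C N : Type*} [AddCommGroup C] [Module k C] [Coalgebra k C] [AddCommGroup N]
    [Module k N] (m : C ⊗[k] C →ₗ[k] N) : C ⊗[k] C →ₗ[k] N ⊗[k] C :=
  m.rTensor C ∘ₗ (TensorProduct.assoc k C C C).symm.toLinearMap ∘ₗ comul.lTensor C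

theorem comulFold_comul {C R : Type*} [AddCommGroup C] [Module k C] [Coalgebra k C] [Ring R]
    [Algebra k R] {m : C ⊗[k] C →ₗ[k] R} (hm : m ∘ₗ comul = Algebra.linearMap k R ∘ₗ counit)
    (c : C) : comulFold m (comul c) = 1 ⊗ₜ[k] c := by
  simp only [comulFold, LinearMap.comp_apply, LinearEquiv.coe_coe, coassoc_symm_apply]
  rw [← LinearMap.rTensor_comp_apply, hm, LinearMap.rTensor_comp_apply, rTensor_counit_comul]
  simp

variable (k H) in
/-- The product `a ⊗ b ↦ S(a) b`. -/
def antipodeMul : H ⊗[k] H →ₗ[k] H := LinearMap.mul' k H ∘ₗ (antipode k).rTensor H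

@[simp]
theorem antipodeMul_tmul (a b : H) : antipodeMul k H (a ⊗ₜ b) = antipode k a * b := by
  simp [antipodeMul]

variable (k H) in
theorem antipodeMul_comp_comul :
    antipodeMul k H ∘ₗ comul = Algebra.linearMap k H ∘ₗ counit := by
  ext h
  simp [antipodeMul]

theorem comulFold_antipodeMul_tmul (a b : H) :
    comulFold (antipodeMul k H) (a ⊗ₜ b) = (antipode k a ⊗ₜ[k] (1 : H)) * comul b := by
  simp only [comulFold, LinearMap.comp_apply, LinearMap.lTensor_tmul, LinearEquiv.coe_coe]
  induction comul (R := k) b <;> simp_all [TensorProduct.tmul_add, mul_add]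

variable (k H) in
/-- The product `a ⊗ b ↦ S(b) a`. -/
def antipodeMulSwap : H ⊗[k] H →ₗ[k] H :=
  antipodeMul k H ∘ₗ (TensorProduct.comm k H H).toLinearMap

@[simp]
theorem antipodeMulSwap_tmul (a b : H) :
    antipodeMulSwap k H (a ⊗ₜ b) = antipode k b * a := by
  simp [antipodeMulSwap]

theorem IsInvolutory.antipodeMulSwap_comp_comul (hS : IsInvolutory k H) :
    antipodeMulSwap k H ∘ₗ comul = Algebra.linearMap k H ∘ₗ counit := by
  have antipode_comp : antipode k ∘ₗ antipodeMul k H = antipodeMulSwap k H := by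
    ext a b
    simp [antipode_mul_antidistrib, hS a]
  rw [← antipode_comp, LinearMap.comp_assoc, antipodeMul_comp_comul]
  ext h
  simp [Algebra.algebraMap_eq_smul_one]

theorem comulFold_antipodeMulSwap_tmul (a b : H) :
    comulFold (antipodeMulSwap k H) (a ⊗ₜ b) =
      (antipode k).rTensor H (comul b) * (a ⊗ₜ[k] (1 : H)) := by
  simp only [comulFold, LinearMap.comp_apply, LinearMap.lTensor_tmul, LinearEquiv.coe_coe]
  induction comul (R := k) b <;> simp_all [TensorProduct.tmul_add, add_mul]

theorem antipodeMulSwap_eq_sum {ι : Type*} [Fintype ι] {f : ι → H →ₗ[k] k} {p : ι → H}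
    (hfp : IsDualBases f p) (t : H ⊗[k] H) :
    antipodeMulSwap k H t = ∑ i, antipode k (p i) * slice (f i) t := by
  induction t with
  | zero => simp
  | add x y hx hy => simp only [map_add, mul_add, hx, hy, Finset.sum_add_distrib]
  | tmul a b =>
    conv_lhs => rw [hfp b]
    simp [Finset.sum_mul]

section Integral

variable {Λ : H}

theorem antipode_tmul_one_mul_comul_integral (hΛ : Λ ∈ leftIntegrals k H) (h : H) :
    (antipode k h ⊗ₜ[k] (1 : H)) * comul Λ = ((1 : H) ⊗ₜ[k] h) * comul Λ := by
  have absorb (t : H ⊗[k] H) : comulFold (antipodeMul k H) t * comul Λ =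
      (antipode k (slice counit t) ⊗ₜ[k] (1 : H)) * comul Λ := by
    induction t with
    | zero => simp
    | add x y hx hy => simp only [map_add, add_mul, TensorProduct.add_tmul, hx, hy]
    | tmul a b =>
      rw [comulFold_antipodeMul_tmul, mul_assoc, ← Bialgebra.comul_mul, hΛ b]
      simp [← TensorProduct.smul_tmul']
  rw [← comulFold_comul (antipodeMul_comp_comul k H) h, absorb, ← hit_apply, hit_counit]

theorem IsInvolutory.mul_hit_integral (hS : IsInvolutory k H) (hΛ : Λ ∈ leftIntegrals k H)
    (x : H) (g : Module.Dual k H) :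
    x * hit Λ g = hit Λ (g ∘ₗ LinearMap.mulLeft k (antipode k x)) :=
  calc x * hit Λ g = slice g ((antipode k (antipode k x) ⊗ₜ[k] (1 : H)) * comul Λ) := by
        simp [slice_tmul_mul, hS x, hit_apply]
    _ = slice g (((1 : H) ⊗ₜ[k] antipode k x) * comul Λ) := by
        rw [antipode_tmul_one_mul_comul_integral hΛ]
    _ = hit Λ (g ∘ₗ LinearMap.mulLeft k (antipode k x)) := by
        rw [slice_tmul_mul, one_mul, hit_apply]

theorem IsInvolutory.hit_surjective [Module.Finite k H] [Module.Projective k H]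
    (hS : IsInvolutory k H) (hΛ : Λ ∈ leftIntegrals k H) {φ : Module.Dual k H} (hφ : φ Λ = 1) :
    Function.Surjective (hit (k := k) Λ) := by
  obtain ⟨n, f, p, hfp⟩ := exists_isDualBases k H
  have one_eq_sum : 1 = ∑ i, antipode k (p i) * hit Λ (f i ∘ₗ slice φ ∘ₗ comul) :=
    calc (1 : H) = antipodeMulSwap k H (comul (hit Λ φ)) := by
          have := LinearMap.congr_fun hS.antipodeMulSwap_comp_comul (hit Λ φ)
          simpa [counit_hit, hφ] using this.symm
      _ = _ := by simp only [antipodeMulSwap_eq_sum hfp, ← hit_apply, hit_hit]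
  intro x
  refine ⟨∑ i, (f i ∘ₗ slice φ ∘ₗ comul) ∘ₗ LinearMap.mulLeft k (antipode k (x * antipode k (p i))),
    ?_⟩
  simp only [map_sum, ← hS.mul_hit_integral hΛ, mul_assoc, ← Finset.mul_sum, ← one_eq_sum, mul_one]

end Integral

theorem IsFrobeniusAlgebra.exists_integral_eval_eq_one (hF : IsFrobeniusAlgebra k H) :
    ∃ Λ ∈ leftIntegrals k H, ∃ φ : Module.Dual k H, φ Λ = 1 := by
  obtain ⟨_, _, e, he⟩ := hF
  obtain ⟨Λ, hΛ⟩ : ∃ Λ, e Λ = counit := e.surjective _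
  refine ⟨Λ, fun b => e.injective <| LinearMap.ext fun x => ?_, e 1, ?_⟩
  · rw [he, map_smul, hΛ, Bialgebra.counit_mul, mul_comm, LinearMap.smul_apply, smul_eq_mul]
  · rw [← one_mul Λ, ← he, mul_one, hΛ, Bialgebra.counit_one]

/-- A left integral `Λ` and a linear form `l` with `Λ₁ l(Λ₂) = 1`, where moreover `g ↦ Λ₁ g(Λ₂)`
is injective: `l` is a Frobenius form of `H`, and `S(Λ₁) ⊗ Λ₂` is the dual basis element. -/
structure IsFrobeniusPair (Λ : H) (l : Module.Dual k H) : Prop where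
  mem_leftIntegrals : Λ ∈ leftIntegrals k H
  hit_injective : Function.Injective (hit (k := k) Λ)
  hit_eq_one : hit Λ l = 1

theorem IsInvolutory.exists_isFrobeniusPair (hS : IsInvolutory k H)
    (hF : IsFrobeniusAlgebra k H) :
    ∃ (Λ : H) (l : Module.Dual k H), IsFrobeniusPair Λ l := by
  obtain ⟨Λ, hΛ, φ, hφ⟩ := hF.exists_integral_eval_eq_one
  obtain ⟨_, _, e, -⟩ := hF
  have hsurj : Function.Surjective (hit (k := k) Λ) := hS.hit_surjective hΛ hφ
  have hinj : Function.Injective (hit Λ ∘ₗ e.toLinearMap) :=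
    OrzechProperty.injective_of_surjective_endomorphism _ (hsurj.comp e.surjective)
  obtain ⟨l, hl⟩ := hsurj 1
  exact ⟨Λ, l, hΛ, Function.Injective.of_comp_right (f := hit Λ) (g := e) hinj e.surjective, hl⟩

/-- A left integral `l` of the dual algebra: `h₁ l(h₂) = l(h) 1`. -/
def IsLeftCointegral (l : Module.Dual k H) : Prop :=
  slice l ∘ₗ comul = Algebra.linearMap k H ∘ₗ l

namespace IsFrobeniusPair

variable {Λ : H} {l : Module.Dual k H}

theorem apply_integral (hp : IsFrobeniusPair Λ l) : l Λ = 1 := by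
  rw [← counit_hit, hp.hit_eq_one, Bialgebra.counit_one]

theorem isLeftCointegral [Module.Projective k H] (hp : IsFrobeniusPair Λ l) :
    IsLeftCointegral l := by
  have key (f : Module.Dual k H) : f ∘ₗ slice l ∘ₗ comul = f 1 • l :=
    hp.hit_injective <|
      calc hit Λ (f ∘ₗ slice l ∘ₗ comul) = hit 1 f := by rw [← hit_hit, hp.hit_eq_one]
        _ = f 1 • 1 := by simp [hit_apply, Algebra.TensorProduct.one_def]
        _ = hit Λ (f 1 • l) := by rw [map_smul, hp.hit_eq_one]
  ext h
  rw [← sub_eq_zero, ← Module.forall_dual_apply_eq_zero_iff k]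
  intro f
  have := LinearMap.congr_fun (key f) h
  simp only [LinearMap.comp_apply, LinearMap.smul_apply, smul_eq_mul] at this
  simp [this, Algebra.algebraMap_eq_smul_one, mul_comm]

theorem hit_comp_mulLeft (hp : IsFrobeniusPair Λ l) (x : H) :
    hit Λ (l ∘ₗ LinearMap.mulLeft k x) = antipode k x :=
  calc hit Λ (l ∘ₗ LinearMap.mulLeft k x) = slice l (((1 : H) ⊗ₜ[k] x) * comul Λ) := by
        rw [slice_tmul_mul, one_mul, hit_apply]
    _ = slice l ((antipode k x ⊗ₜ[k] (1 : H)) * comul Λ) := by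
        rw [antipode_tmul_one_mul_comul_integral hp.mem_leftIntegrals]
    _ = antipode k x := by simp [slice_tmul_mul, ← hit_apply, hp.hit_eq_one]

theorem apply_antipode_hit_mul (hp : IsFrobeniusPair Λ l) (hS : IsInvolutory k H)
    (g : Module.Dual k H) (y : H) : l (antipode k (hit Λ g) * y) = g y := by
  have : l ∘ₗ LinearMap.mulLeft k (antipode k (hit Λ g)) = g :=
    hp.hit_injective <| by rw [hp.hit_comp_mulLeft, hS]
  exact LinearMap.congr_fun this y

theorem isDualBases_right (hp : IsFrobeniusPair Λ l) (hS : IsInvolutory k H) {ι : Type*}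
    (r : Repr k Λ ι) :
    IsDualBases (fun i : r.index => l ∘ₗ LinearMap.mulRight k (r.right i))
      (fun i => antipode k (r.left i)) := by
  intro x
  conv_lhs => rw [← hS x, ← hp.hit_comp_mulLeft x, hit_apply, ← r.eq, ← Finset.sum_coe_sort]
  simp

theorem isDualBases_left [Module.Projective k H] (hp : IsFrobeniusPair Λ l)
    (hS : IsInvolutory k H) {ι : Type*} (r : Repr k Λ ι) :
    IsDualBases (fun i : r.index => l ∘ₗ LinearMap.mulLeft k (antipode k (r.left i)))
      (fun i => r.right i) := by
  intro y
  rw [← sub_eq_zero, ← Module.forall_dual_apply_eq_zero_iff k]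
  intro g
  rw [map_sub, ← hp.apply_antipode_hit_mul hS g y, hit_apply, ← r.eq, ← Finset.sum_coe_sort]
  simp [Finset.sum_mul, mul_comm]

theorem apply_antipode_mul_mul [Module.Projective k H] (hp : IsFrobeniusPair Λ l)
    (hS : IsInvolutory k H) (h : H) :
    l (LinearMap.mul' k H (((1 : H) ⊗ₜ[k] h) * (antipode k).rTensor H (comul Λ))) =
      counit Λ * l h := by
  obtain r := ℛ k Λ
  have htrace := (hp.isDualBases_left hS r).trace_eq (hp.isDualBases_right hS r)
    (LinearMap.mulLeft k h)
  simp only [LinearMap.comp_apply, LinearMap.mulLeft_apply, LinearMap.mulRight_apply,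
    Finset.sum_coe_sort r.index fun i => l (antipode k (r.left i) * (h * r.right i)),
    Finset.sum_coe_sort r.index fun i => l (h * antipode k (r.left i) * r.right i)] at htrace
  calc l (LinearMap.mul' k H (((1 : H) ⊗ₜ[k] h) * (antipode k).rTensor H (comul Λ)))
      = ∑ i ∈ r.index, l (antipode k (r.left i) * (h * r.right i)) := by
        simp [← r.eq, Finset.mul_sum]
    _ = ∑ i ∈ r.index, l (h * antipode k (r.left i) * r.right i) := htrace
    _ = l (h * ∑ i ∈ r.index, antipode k (r.left i) * r.right i) := by
        simp [Finset.mul_sum, mul_assoc]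
    _ = counit Λ * l h := by simp [sum_antipode_mul_eq_smul]

end IsFrobeniusPair

end Hopf

namespace RightComoduleAlgebra

variable {k H B : Type*} [CommRing k] [Ring H] [HopfAlgebra k H] [Ring B] [Algebra k B]
  (ρ : RightComoduleAlgebra k H B)

theorem slice_counit_coact (b : B) : slice Coalgebra.counit (ρ.coact b) = b :=
  LinearMap.congr_fun ρ.counit b

theorem lTensor_algebraMap_comp_coact (g : Module.Dual k H) (b : B) :
    (Algebra.linearMap k H ∘ₗ g).lTensor B (ρ.coact b) = slice g (ρ.coact b) ⊗ₜ[k] (1 : H) := by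
  induction ρ.coact b <;>
    simp_all [Algebra.algebraMap_eq_smul_one, TensorProduct.smul_tmul', TensorProduct.add_tmul]

/-- The map `b ⊗ h ↦ b₀ ⊗ K (b₁ ⊗ h)`. It carries identities in `B ⊗ H` to identities in which
the coaction has been applied once more and recombined by `K`. -/
def coactTwist {N : Type*} [AddCommGroup N] [Module k N] (K : H ⊗[k] H →ₗ[k] N) :
    B ⊗[k] H →ₗ[k] B ⊗[k] N :=
  K.lTensor B ∘ₗ (TensorProduct.assoc k B H H).toLinearMap ∘ₗ ρ.coact.toLinearMap.rTensor H

section Twist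

variable {N : Type*} [AddCommGroup N] [Module k N] (K : H ⊗[k] H →ₗ[k] N)

theorem coactTwist_tmul (b : B) (h : H) :
    ρ.coactTwist K (b ⊗ₜ h) =
      (K ∘ₗ (TensorProduct.mk k H H).flip h).lTensor B (ρ.coact b) := by
  simp only [coactTwist, LinearMap.comp_apply, LinearMap.rTensor_tmul, AlgHom.toLinearMap_apply]
  induction ρ.coact b <;> simp_all [TensorProduct.add_tmul]

theorem coactTwist_one_tmul (h : H) :
    ρ.coactTwist K ((1 : B) ⊗ₜ h) = (1 : B) ⊗ₜ K ((1 : H) ⊗ₜ h) := by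
  simp [coactTwist_tmul, Algebra.TensorProduct.one_def]

theorem coactTwist_coact (b : B) :
    ρ.coactTwist K (ρ.coact b) = (K ∘ₗ comul).lTensor B (ρ.coact b) := by
  rw [LinearMap.lTensor_comp_apply]
  exact congrArg _ (LinearMap.congr_fun ρ.coassoc b)

end Twist

section Galois

variable (k H) in
/-- The product `a ⊗ b ↦ a S(b)`. -/
def mulAntipode : H ⊗[k] H →ₗ[k] H := LinearMap.mul' k H ∘ₗ (antipode k).lTensor H

theorem coactTwist_mulAntipode_coact (b : B) :
    ρ.coactTwist (mulAntipode k H) (ρ.coact b) = b ⊗ₜ[k] (1 : H) := by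
  have : mulAntipode k H ∘ₗ comul = Algebra.linearMap k H ∘ₗ Coalgebra.counit := by
    ext h
    simp [mulAntipode]
  rw [coactTwist_coact, this, lTensor_algebraMap_comp_coact, slice_counit_coact]

theorem coactTwist_mulAntipode_tmul_one_mul (b : B) (t : B ⊗[k] H) :
    ρ.coactTwist (mulAntipode k H) ((b ⊗ₜ[k] (1 : H)) * t) =
      ρ.coact b * ρ.coactTwist (mulAntipode k H) t := by
  induction t with
  | zero => simp
  | add x y hx hy => simp only [map_add, mul_add, hx, hy]
  | tmul c h =>
    have key := lTensor_mul_of_map_mul (j := LinearMap.id)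
      (T := mulAntipode k H ∘ₗ (TensorProduct.mk k H H).flip h)
      (T' := mulAntipode k H ∘ₗ (TensorProduct.mk k H H).flip h)
      (fun a x => by simp [mulAntipode, mul_assoc]) (ρ.coact b) (ρ.coact c)
    simpa [coactTwist_tmul] using key

theorem coactTwist_mulAntipode_leftCan (z : BalancedTensor ρ.coinvariants) :
    ρ.coactTwist (mulAntipode k H) (ρ.leftCan z) = ρ.rightCan z := by
  obtain ⟨t, rfl⟩ := Submodule.Quotient.mk_surjective _ z
  induction t with
  | zero => simp
  | add x y hx hy => simp only [Submodule.Quotient.mk_add, map_add, hx, hy]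
  | tmul b b' =>
    rw [leftCan_mk_tmul, rightCan_mk_tmul, coactTwist_mulAntipode_tmul_one_mul,
      coactTwist_mulAntipode_coact]

variable {ρ} in
theorem IsHopfGalois.exists_rightCan_eq (hGalois : ρ.IsHopfGalois) (hS : IsInvolutory k H)
    (h : H) : ∃ z, ρ.rightCan z = (1 : B) ⊗ₜ[k] h := by
  obtain hleft | hright := hGalois
  · obtain ⟨z, hz⟩ := hleft.surjective ((1 : B) ⊗ₜ[k] antipode k h)
    refine ⟨z, ?_⟩
    rw [← coactTwist_mulAntipode_leftCan, hz, coactTwist_one_tmul]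
    simp [mulAntipode, hS h]
  · exact hright.surjective _

variable {ρ} in
theorem IsHopfGalois.exists_sum_coact_mul (hGalois : ρ.IsHopfGalois) (hS : IsInvolutory k H)
    (h : H) : ∃ (n : ℕ) (x y : Fin n → B),
      ∑ i, ρ.coact (x i) * (y i ⊗ₜ[k] (1 : H)) = (1 : B) ⊗ₜ[k] h := by
  obtain ⟨z, hz⟩ := hGalois.exists_rightCan_eq hS h
  obtain ⟨t, rfl⟩ := Submodule.Quotient.mk_surjective _ z
  obtain ⟨n, x, y, rfl⟩ := TensorProduct.exists_sum_tmul_eq t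
  refine ⟨n, x, y, ?_⟩
  rw [← hz, ← Submodule.mkQ_apply, map_sum, map_sum]
  exact Finset.sum_congr rfl fun i _ => (ρ.rightCan_mk_tmul (x i) (y i)).symm

end Galois

section Trace

variable {l : Module.Dual k H}

theorem slice_coact_mem_coinvariants (hl : IsLeftCointegral l) (b : B) :
    slice l (ρ.coact b) ∈ ρ.coinvariants := by
  rw [mem_coinvariants, ← lTensor_algebraMap_comp_coact, ← hl]
  exact map_slice_of_coassoc ρ.coassoc l b

/-- The trace map `b ↦ b₀ l(b₁)` of `B` over its coinvariants, for a left cointegral `l`. -/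
def coinvariantsTrace (hl : IsLeftCointegral l) : B →ₗ[ρ.coinvariants] ρ.coinvariants where
  toFun b := ⟨slice l (ρ.coact b), ρ.slice_coact_mem_coinvariants hl b⟩
  map_add' x y := by
    ext
    simp
  map_smul' a b := by
    ext
    have ha : ρ.coact a = a.1 ⊗ₜ[k] (1 : H) := ρ.mem_coinvariants.1 a.2
    simp [Subalgebra.smul_def, ha, slice_tmul_mul]

theorem coe_coinvariantsTrace (hl : IsLeftCointegral l) (b : B) :
    (ρ.coinvariantsTrace hl b : B) = slice l (ρ.coact b) := rfl

variable {Λ : H} {ι : Type*} [Fintype ι] {x y : ι → B}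

theorem isDualBases_coinvariants (hΛ : Λ ∈ leftIntegrals k H) (hl : IsLeftCointegral l)
    (hlΛ : l Λ = 1) (hxy : ∑ i, ρ.coact (x i) * (y i ⊗ₜ[k] (1 : H)) = (1 : B) ⊗ₜ[k] Λ) :
    IsDualBases (fun i => ρ.coinvariantsTrace hl ∘ₗ
      (LinearMap.toSpanSingleton B B (x i)).restrictScalars ρ.coinvariants) y := by
  intro b
  have hΛl : l ∘ₗ LinearMap.mulRight k Λ = Coalgebra.counit := by
    ext h
    simp [hΛ h, hlΛ]
  calc b = slice l (ρ.coact b * ((1 : B) ⊗ₜ[k] Λ)) := by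
        rw [slice_mul_tmul, hΛl, mul_one, slice_counit_coact]
    _ = ∑ i, slice l (ρ.coact (b * x i) * (y i ⊗ₜ[k] (1 : H))) := by
        simp only [← hxy, Finset.mul_sum, map_sum, map_mul, mul_assoc]
    _ = _ := by
        simp [slice_mul_tmul, Subalgebra.smul_def, coe_coinvariantsTrace, -map_mul]

theorem coactTwist_comulFold_mul_tmul_one (t : B ⊗[k] H) (b : B) :
    ρ.coactTwist (comulFold (antipodeMulSwap k H)) (t * (b ⊗ₜ[k] (1 : H))) =
      ρ.coactTwist (comulFold (antipodeMulSwap k H)) t *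
        ((TensorProduct.mk k H H).flip 1).lTensor B (ρ.coact b) := by
  induction t with
  | zero => simp
  | add x y hx hy => simp only [map_add, add_mul, hx, hy]
  | tmul c h =>
    simp only [Algebra.TensorProduct.tmul_mul_tmul, mul_one, coactTwist_tmul, map_mul]
    exact lTensor_mul_of_map_mul
      (fun a x => by simp [comulFold_antipodeMulSwap_tmul, mul_assoc]) _ _

theorem sum_coact_mul_coact (hS : IsInvolutory k H)
    (hxy : ∑ i, ρ.coact (x i) * (y i ⊗ₜ[k] (1 : H)) = (1 : B) ⊗ₜ[k] Λ) :
    ∑ i, (TensorProduct.mk k H H 1).lTensor B (ρ.coact (x i)) *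
        ((TensorProduct.mk k H H).flip 1).lTensor B (ρ.coact (y i)) =
      (1 : B) ⊗ₜ[k] (antipode k).rTensor H (comul Λ) := by
  have hcoact (b : B) : ρ.coactTwist (comulFold (antipodeMulSwap k H)) (ρ.coact b) =
      (TensorProduct.mk k H H 1).lTensor B (ρ.coact b) := by
    rw [coactTwist_coact]
    congr 2
    exact LinearMap.ext (comulFold_comul hS.antipodeMulSwap_comp_comul)
  have := congrArg (ρ.coactTwist (comulFold (antipodeMulSwap k H))) hxy
  simpa only [map_sum, coactTwist_comulFold_mul_tmul_one, hcoact, coactTwist_one_tmul,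
    comulFold_antipodeMulSwap_tmul, ← Algebra.TensorProduct.one_def, mul_one] using this

theorem sum_mk_slice_coact [Module.Projective k H] (hS : IsInvolutory k H)
    (hp : IsFrobeniusPair Λ l)
    (hxy : ∑ i, ρ.coact (x i) * (y i ⊗ₜ[k] (1 : H)) = (1 : B) ⊗ₜ[k] Λ) (b : B) :
    ∑ i, TraceGroup.mk B (slice l (ρ.coact (y i * b * x i))) =
      TraceGroup.mk B (Coalgebra.counit (R := k) Λ • slice l (ρ.coact b)) := by
  simp only [map_mul]
  induction ρ.coact b with
  | zero => simp
  | add s t hs ht =>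
    simp only [map_add, mul_add, add_mul, Finset.sum_add_distrib, smul_add, hs, ht]
  | tmul c h =>
    simp only [mk_slice_mul_tmul_mul]
    rw [← map_sum, ← Finset.mul_sum, ← map_sum, ρ.sum_coact_mul_coact hS hxy, slice_tmul,
      slice_tmul, LinearMap.comp_apply, LinearMap.comp_apply, LinearMap.mulLeft_apply,
      hp.apply_antipode_mul_mul hS, mul_smul_comm, mul_one, mul_smul]

theorem map_hattoriRank_coinvariants [Module.Projective k H] (hS : IsInvolutory k H)
    (hp : IsFrobeniusPair Λ l)
    (hxy : ∑ i, ρ.coact (x i) * (y i ⊗ₜ[k] (1 : H)) = (1 : B) ⊗ₜ[k] Λ)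
    {P κ : Type*} [AddCommGroup P] [Module B P] [Module.Finite ρ.coinvariants P]
    [Module.Projective ρ.coinvariants P] [Fintype κ] {f : κ → P →ₗ[B] B} {p : κ → P}
    (hfp : IsDualBases f p) :
    TraceGroup.map (ρ.coinvariants.val : ρ.coinvariants →+* B) (hattoriRank ρ.coinvariants P) =
      TraceGroup.mk B (Coalgebra.counit (R := k) Λ •
        (ρ.coinvariantsTrace hp.isLeftCointegral (∑ j, f j (p j)) : B)) := by
  rw [hattoriRank_of_tower (ρ.isDualBases_coinvariants hp.mem_leftIntegrals hp.isLeftCointegral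
    hp.apply_integral hxy) hfp, map_sum, coe_coinvariantsTrace, ← ρ.sum_mk_slice_coact hS hp hxy]
  rfl

end Trace

end RightComoduleAlgebra

end

theorem proposition3p6 {k : Type v} {H : Type w} {B : Type u} [CommRing k] [Ring H]
    [HopfAlgebra k H] [Ring B] [Algebra k B] (ρ : RightComoduleAlgebra k H B)
    (hGalois : ρ.IsHopfGalois) (hInv : IsInvolutory k H) (hFrob : IsFrobeniusAlgebra k H) :
    ∃ (_ : Module.Finite ρ.coinvariants B) (_ : Module.Projective ρ.coinvariants B),
      ((TraceGroup.map (ρ.coinvariants.val : ρ.coinvariants →+* B)).comp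
          ((K0.rank ρ.coinvariants).comp (K0.res ρ.coinvariants))).range ≤
        AddSubgroup.map (TraceGroup.mk B)
          (integralIdeal k H • Subalgebra.toSubmodule ρ.coinvariants).toAddSubgroup := by
  obtain ⟨Λ, l, hp⟩ := hInv.exists_isFrobeniusPair hFrob
  have := hFrob.2.1
  obtain ⟨n, x, y, hxy⟩ := hGalois.exists_sum_coact_mul hInv Λ
  obtain ⟨hfin, hproj⟩ := (ρ.isDualBases_coinvariants hp.mem_leftIntegrals hp.isLeftCointegral
    hp.apply_integral hxy).finite_projective
  refine ⟨hfin, hproj, K0.range_le fun P => ?_⟩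
  obtain ⟨m, f, p, hfp⟩ := exists_isDualBases B P.carrier
  have := (finite_projective_restrict ρ.coinvariants P.carrier).1
  have := (finite_projective_restrict ρ.coinvariants P.carrier).2
  simp only [AddMonoidHom.comp_apply, K0.res_cls, K0.rank_cls]
  exact ⟨_, Submodule.smul_mem_smul ⟨Λ, hp.mem_leftIntegrals, rfl⟩ (Subtype.property _),
    (ρ.map_hattoriRank_coinvariants hInv hp hxy hfp).symm⟩
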